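/- Let $k\ge 1$ and let $(W(t):t\in\mathbb R^k)$ be a zero-mean real Gaussian random field with variance $\sigma^2(t)=\operatorname{Var}W(t)$ and stationary increments, i.e. $E(W(t)-W(s))^2=\gamma(t-s)$ for all $s,t$, where $\gamma(t)=E(W(t)-W(0))^2$. Let $W_1,W_2,\dots$ be i.i.d. copies of $W$, independent of the points $U_1,U_2,\dots$ of a Poisson point process $\sum_i\delta_{U_i}$ on $(0,\infty)$ with intensity $u^{-2}\,du$, and let $$X(t)=\max_{i\ge1}U_i\exp\{W_i(t)-\sigma^2(t)/2\},\qquad t\in\mathbb Z^k,$$ be the associated Brown–Resnick random field on $\mathbb Z^k$. For $n\in\mathbb N^k$ put $\mathcal R_n=\{t\in\mathbb Z^k:\ |t_\ell|\le n_\ell-1,\ \ell=1,\dots,k\}$, for finite $A\subset\mathbb Z^k$ put $M_X(A)=\max_{t\in A}|X(t)|$ (with $M_X(\emptyset)=0$), and let $n\to\infty$ mean that all coordinates of $n$ tend to infinity. Call a real array $(u_n)_{n\in\mathbb N^k}$ a threshold array if $\bigl(\prod_{\ell}n_\ell\bigr)P(|X(0)|>u_n)\to\tau$ as $n\to\infty$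 for some $\tau>0$; call an array $(r_n)_{n\in\mathbb N^k}$ of elements of $\mathbb N^k$ a block array if it is (coordinatewise) nondecreasing in $n$, $r_n\to\infty$ and $(r_n)_\ell/n_\ell\to0$ for every $\ell$ as $n\to\infty$. The field $X$ satisfies the anti-clustering condition if for any threshold array $(u_n)$ and some block array $(r_n)$, $$\lim_{M\to\infty}\ \limsup_{n\to\infty}\ P\bigl(M_X(\mathcal R_{r_n}\setminus\mathcal R_{(M,\dots,M)})>u_n\ \big|\ |X(0)|>u_n\bigr)=0.\tag{1}$$ Then $X$ satisfies the anti-clustering condition if and only if $$\lim_{\|t\|\to\infty,\ t\in\mathbb Z^k}\bigl(W(t)-\sigma^2(t)/2\bigr)=-\infty\quad\text{a.s.}\tag{2}$$ Moreover, the choice of the arrays is immaterial: for every threshold array $(u_n)$ and every block array $(r_n)$, (1) holds if and only if (2) holds. -/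

import Mathlib

open MeasureTheory ProbabilityTheory Filter Topology
open scoped ENNReal NNReal

/-! ### Gaussian fields with stationary increments -/

section GaussianFields

variable {k : ℕ} {Ω : Type*} [MeasurableSpace Ω]

/-- The variogram `γ(t) = E (W(t) - W(0))²` of a random field on `ℝ^k`. -/
noncomputable def variogram (W : (Fin k → ℝ) → Ω → ℝ) (P : Measure Ω) (t : Fin k → ℝ) : ℝ :=
  ∫ ω, (W t ω - W 0 ω) ^ 2 ∂P

/-- A zero-mean Gaussian random field `W` on `ℝ^k` with stationary increments,
i.e. `E (W(t) - W(s))² = γ(t - s)` for all `s, t`. -/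
structure IsStationaryIncrementGaussianField (W : (Fin k → ℝ) → Ω → ℝ) (P : Measure Ω) :
    Prop where
  measurable : ∀ t, Measurable (W t)
  gaussian : IsGaussianProcess W P
  zero_mean : ∀ t, ∫ ω, W t ω ∂P = 0
  stationary_increments : ∀ s t, ∫ ω, (W t ω - W s ω) ^ 2 ∂P = variogram W P (t - s)

end GaussianFields

/-! ### Poisson point processes -/

section PoissonProcess

variable {Ω E : Type*} [MeasurableSpace Ω] [MeasurableSpace E]

/-- The random measure `N` is a Poisson point process on `E` with intensity measure `μ`:
`N(B)` is Poisson with mean `μ(B)` (almost surely infinite if `μ(B) = ∞`), and the counts of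
pairwise disjoint sets are independent. -/
structure IsPoissonPointProcess (N : Ω → Measure E) (μ : Measure E) (P : Measure Ω) : Prop where
  measurable : ∀ B, MeasurableSet B → Measurable fun ω => N ω B
  law_of_finite : ∀ B, MeasurableSet B → μ B < ∞ →
    P.map (fun ω => N ω B) = (poissonMeasure (μ B).toNNReal).map (fun n : ℕ => (n : ℝ≥0∞))
  law_of_infinite : ∀ B, MeasurableSet B → μ B = ∞ → ∀ᵐ ω ∂P, N ω B = ∞
  indep : ∀ (m : ℕ) (B : Fin m → Set E), (∀ j, MeasurableSet (B j)) →
    Pairwise (Function.onFun Disjoint B) → iIndepFun (fun j ω => N ω (B j)) P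

/-- The point measure `∑ i, δ_{U i}`. -/
noncomputable def pointMeasure (U : ℕ → Ω → E) (ω : Ω) : Measure E :=
  Measure.sum fun i => Measure.dirac (U i ω)

/-- The measure `u⁻² du` on `(0, ∞)`, as a measure on `ℝ`. -/
noncomputable def inverseSquareIntensity : Measure ℝ :=
  (volume.restrict (Set.Ioi (0 : ℝ))).withDensity fun u => ENNReal.ofReal (1 / u ^ 2)

end PoissonProcess

/-! ### Brown–Resnick random fields -/

section BrownResnick

variable {k : ℕ} {Ω Ω' : Type*} [MeasurableSpace Ω] [MeasurableSpace Ω']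

/-- The ingredients of the Brown–Resnick field associated with the field `W` (on `(Ω', P')`):
the fields `Wc i` (on `(Ω, P)`) are i.i.d. copies of `W`, and they are independent of the points
`U i` of a Poisson process on `(0, ∞)` with intensity `u⁻² du`. -/
structure IsBrownResnickInput (W : (Fin k → ℝ) → Ω' → ℝ) (P' : Measure Ω')
    (Wc : ℕ → (Fin k → ℝ) → Ω → ℝ) (U : ℕ → Ω → ℝ) (P : Measure Ω) : Prop where
  measurable_copies : ∀ i t, Measurable (Wc i t)
  measurable_points : ∀ i, Measurable (U i)
  copies : ∀ i, IdentDistrib (fun ω t => Wc i t ω) (fun ω t => W t ω) P P'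
  indep_copies : iIndepFun (fun i ω t => Wc i t ω) P
  poisson : IsPoissonPointProcess (pointMeasure U) inverseSquareIntensity P
  indep_points : IndepFun (fun ω i => U i ω) (fun ω i t => Wc i t ω) P

/-- The field `X(t) = max_i U_i exp (W_i(t) - σ²(t) / 2)`, where `σ²` is given as `v`. For the input
above, almost surely the supremum is finite and attained at every `t ∈ ℤ^k`. -/
noncomputable def brownResnickField (U : ℕ → Ω → ℝ) (Wc : ℕ → (Fin k → ℝ) → Ω → ℝ)
    (v : (Fin k → ℝ) → ℝ) (t : Fin k → ℝ) (ω : Ω) : ℝ :=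
  ⨆ i : ℕ, U i ω * Real.exp (Wc i t ω - v t / 2)

/-- A point of the grid `ℤ^k`, as a point of `ℝ^k`. -/
def gridPoint (t : Fin k → ℤ) : Fin k → ℝ := fun l => (t l : ℝ)

end BrownResnick

/-! ### The anti-clustering condition -/

section AntiClustering

variable {k : ℕ} {Ω E : Type*} [MeasurableSpace Ω] [NormedAddCommGroup E]

/-- The hypercube `R_n = [-n + 1 : n - 1]` in `ℤ^k`. -/
noncomputable def hypercube (n : Fin k → ℕ) : Finset (Fin k → ℤ) :=
  Finset.Icc (fun l => -(n l : ℤ) + 1) (fun l => (n l : ℤ) - 1)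

/-- `M_X(A) = max_{t ∈ A} ‖X(t)‖` for a finite set `A` (and `0` for empty `A`). -/
noncomputable def fieldMax (X : (Fin k → ℤ) → Ω → E) (A : Finset (Fin k → ℤ)) (ω : Ω) : ℝ :=
  ((A.sup fun t => ‖X t ω‖₊ : ℝ≥0) : ℝ)

/-- The array `u` satisfies `(∏ n_l) P(‖X(0)‖ > u_n) → τ` as all the coordinates of `n` tend
to infinity (which is the filter `atTop` on `Fin k → ℕ`). -/
def IsThresholdArray (X : (Fin k → ℤ) → Ω → E) (P : Measure Ω) (τ : ℝ)
    (u : (Fin k → ℕ) → ℝ) : Prop :=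
  Tendsto (fun n : Fin k → ℕ => (∏ l, (n l : ℝ)) * P.real {ω | u n < ‖X 0 ω‖}) atTop (𝓝 τ)

/-- The array `r` of elements of `ℕ^k` increases to infinity and `r_n / n → 0` coordinatewise. -/
structure IsBlockArray (r : (Fin k → ℕ) → (Fin k → ℕ)) : Prop where
  mono : Monotone r
  tendsto_atTop : Tendsto r atTop atTop
  negligible : ∀ l, Tendsto (fun n : Fin k → ℕ => (r n l : ℝ) / (n l : ℝ)) atTop (𝓝 0)

/-- `lim_M limsup_n P(M_X(R_{r_n} \ R_{(M,…,M)}) > u_n | ‖X(0)‖ > u_n) = 0`. -/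
def VanishesAlong (X : (Fin k → ℤ) → Ω → E) (P : Measure Ω) (u : (Fin k → ℕ) → ℝ)
    (r : (Fin k → ℕ) → (Fin k → ℕ)) : Prop :=
  Tendsto (fun M : ℕ => limsup (fun n : Fin k → ℕ =>
      cond P {ω | u n < ‖X 0 ω‖}
        {ω | u n < fieldMax X (hypercube (r n) \ hypercube fun _ => M) ω}) atTop)
    atTop (𝓝 0)

/-- The anti-clustering condition: for any threshold array (for some `τ > 0`) and some block array,
the above limit relation holds. -/
def AntiClustering (X : (Fin k → ℤ) → Ω → E) (P : Measure Ω) : Prop :=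
  ∀ u : (Fin k → ℕ) → ℝ, (∃ τ : ℝ, 0 < τ ∧ IsThresholdArray X P τ u) →
    ∃ r : (Fin k → ℕ) → (Fin k → ℕ), IsBlockArray r ∧ VanishesAlong X P u r

end AntiClustering

/-! ### Laplace functional of a Poisson process. -/

section PoissonLaplace

/-! Write Y(t) = exp(W(t) - σ²(t)/2), so E Y(t) = 1, and θ(A) = E max_A Y for finite A. The pairs
(U_i, W_i) form a Poisson process with independent marks, and max_A X ≤ x says that no pair
satisfies U_i · max_A Y_i > x. The mean number of such pairs is θ(A)/x, hence P(max_A X ≤ x) =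
exp(-θ(A)/x) (`measure_forall_mul_le`, `measureReal_lt_fieldMax`).

Inclusion-exclusion turns the conditional probability of an exceedance in A, given one at 0, into an
explicit function of θ(A), c = E[max_A Y ∧ Y(0)] and 1/x, because θ(A ∪ {0}) = θ(A) + 1 - c. It
differs from c by at most exp(1/x) - 1 downwards and |A|/x upwards (`cond_lt_fieldMax_bounds`).
Along a threshold and a block array both errors vanish, since u_n has the order of ∏ n_l while
|R_{r_n}| is of smaller order. So for each M the conditional probabilities converge to E[sup_{t ∉
R_M} Y(t) ∧ Y(0)], whatever the arrays are (`tendsto_cond_fieldMax`).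

As M → ∞ this decreases to E[inf_M sup_{t ∉ R_M} Y(t) ∧ Y(0)]. As Y(0) > 0, that is zero iff Y(t) →
0 almost surely, i.e. iff log Y(t) → -∞ (`tendsto_clusterLimit_zero_iff`). -/

lemma lintegral_one_sub_pow_poissonMeasure (r : ℝ≥0) {c : ℝ≥0∞} (hc : c ≤ 1) :
    ∫⁻ n, (1 - c) ^ n ∂poissonMeasure r = ENNReal.ofReal (Real.exp (-(c * r).toReal)) := by
  have hc' : c ≠ ∞ := (hc.trans_lt ENNReal.one_lt_top).ne
  have hx0 : 0 ≤ 1 - c.toReal := by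
    have := ENNReal.toReal_mono ENNReal.one_ne_top hc
    simp at this
    linarith
  have hq : 1 - c = ENNReal.ofReal (1 - c.toReal) := by
    rw [ENNReal.ofReal_sub _ ENNReal.toReal_nonneg, ENNReal.ofReal_toReal hc', ENNReal.ofReal_one]
  rw [poissonMeasure, lintegral_sum_measure]
  have hterm : ∀ n : ℕ, ∫⁻ m, (1 - c) ^ m ∂(ENNReal.ofReal
      (Real.exp (-r) * r ^ n / (n.factorial : ℝ)) • (Measure.dirac n : Measure ℕ)) =
      ENNReal.ofReal (Real.exp (-r) * ((r * (1 - c.toReal)) ^ n / (n.factorial : ℝ))) := by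
    intro n
    rw [lintegral_smul_measure, lintegral_dirac, hq, ← ENNReal.ofReal_pow hx0, smul_eq_mul,
      ← ENNReal.ofReal_mul (by positivity)]
    congr 1
    rw [mul_pow]
    ring
  simp_rw [hterm]
  have hs := (NormedSpace.expSeries_div_hasSum_exp ((r : ℝ) * (1 - c.toReal))).mul_left
    (Real.exp (-r))
  rw [← ENNReal.ofReal_tsum_of_nonneg (fun n => by positivity) hs.summable, hs.tsum_eq,
    ← Real.exp_eq_exp_ℝ, ← Real.exp_add]
  congr 2
  simp
  ring

variable {Ω E : Type*} [MeasurableSpace Ω] [MeasurableSpace E]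

/-- For `c = 0` the base is 1, so an infinite count, whose `toReal` is 0, does no harm. This case is
needed for the zero fibre of a simple function, which may have infinite intensity. -/
lemma lintegral_one_sub_rpow_count {N : Ω → Measure E} {μ : Measure E} {P : Measure Ω}
    [IsProbabilityMeasure P] (hN : IsPoissonPointProcess N μ P) {B : Set E}
    (hB : MeasurableSet B) {c : ℝ≥0∞} (hc : c ≤ 1) (hμ : c = 0 ∨ μ B < ∞) :
    ∫⁻ ω, (1 - c) ^ (N ω B).toReal ∂P = ENNReal.ofReal (Real.exp (-(c * μ B).toReal)) := by
  rcases eq_or_ne c 0 with rfl | hc0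
  · simp
  have hfin : μ B < ∞ := hμ.resolve_left hc0
  have hmeas : Measurable fun x : ℝ≥0∞ => (1 - c) ^ x.toReal := by fun_prop
  rw [← lintegral_map (f := fun x : ℝ≥0∞ => (1 - c) ^ x.toReal) hmeas (hN.measurable B hB),
    hN.law_of_finite B hB hfin, lintegral_map hmeas (by fun_prop)]
  simp only [ENNReal.toReal_natCast, ENNReal.rpow_natCast]
  rw [lintegral_one_sub_pow_poissonMeasure _ hc, ENNReal.coe_toNNReal hfin.ne]

-- A finite count means that only finitely many indices hit `B`, so a long enough initial segment
-- sees them all.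
open Classical in
omit [MeasurableSpace Ω] in
lemma eventually_card_eq_pointMeasure (U : ℕ → Ω → E) {ω : Ω} {B : Set E}
    (hB : MeasurableSet B) (hfin : pointMeasure U ω B < ∞) :
    ∀ᶠ m in atTop, (((Finset.range m).filter fun i => U i ω ∈ B).card : ℝ≥0∞) =
      pointMeasure U ω B := by
  have hsum : pointMeasure U ω B = ∑' i, B.indicator (1 : E → ℝ≥0∞) (U i ω) := by
    simp [pointMeasure, Measure.sum_apply _ hB, Measure.dirac_apply' _ hB]
  have hS : {i | U i ω ∈ B}.Finite := by
    refine (ENNReal.finite_const_le_of_tsum_ne_top (hsum ▸ hfin.ne) one_ne_zero).subset ?_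
    intro i hi
    simp only [Set.mem_ofPred_eq] at hi
    simp [hi]
  obtain ⟨m₀, hm₀⟩ := hS.bddAbove
  filter_upwards [eventually_gt_atTop m₀] with m hm
  have hz : ∀ i ∉ Finset.range m, B.indicator (1 : E → ℝ≥0∞) (U i ω) = 0 := by
    intro i hi
    refine Set.indicator_of_notMem (fun hiB => hi ?_) _
    exact Finset.mem_range.2 ((hm₀ hiB).trans_lt hm)
  rw [hsum, tsum_eq_sum hz]
  simp [Set.indicator_apply, Finset.sum_boole]

lemma IsPoissonPointProcess.ae_count_lt_top {N : Ω → Measure E} {μ : Measure E} {P : Measure Ω}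
    (hN : IsPoissonPointProcess N μ P) {B : Set E}
    (hB : MeasurableSet B) (hμ : μ B < ∞) : ∀ᵐ ω ∂P, N ω B < ∞ := by
  have hlaw := hN.law_of_finite B hB hμ
  have : ∀ᵐ x ∂(P.map fun ω => N ω B), x < ∞ := by
    rw [hlaw, ae_map_iff (by fun_prop) measurableSet_Iio]
    simp
  exact ae_of_ae_map (hN.measurable B hB).aemeasurable this

/-- The infinite product `∏ᵢ (1 - h (xᵢ))` of numbers in `[0, 1]`. -/
noncomputable def prodOneSub (h : E → ℝ≥0∞) (x : ℕ → E) : ℝ≥0∞ :=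
  ⨅ m, ∏ i ∈ Finset.range m, (1 - h (x i))

omit [MeasurableSpace E] in
lemma antitone_prod_one_sub (h : E → ℝ≥0∞) (x : ℕ → E) :
    Antitone fun m => ∏ i ∈ Finset.range m, (1 - h (x i)) := by
  refine antitone_nat_of_succ_le fun m => ?_
  rw [Finset.prod_range_succ]
  exact mul_le_of_le_one_right' tsub_le_self

lemma measurable_prodOneSub {h : E → ℝ≥0∞} (hh : Measurable h) {U : ℕ → Ω → E}
    (hU : ∀ i, Measurable (U i)) : Measurable fun ω => prodOneSub h fun i => U i ω := by
  unfold prodOneSub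
  refine Measurable.iInf fun m => Finset.measurable_prod _ fun i _ => ?_
  exact measurable_const.sub (hh.comp (hU i))

omit [MeasurableSpace E] in
lemma prodOneSub_le_one (h : E → ℝ≥0∞) (x : ℕ → E) : prodOneSub h x ≤ 1 :=
  (iInf_le _ 0).trans (by simp)

-- Grouping the factors by the value of `h` leaves finitely many powers; each exponent stabilises,
-- except possibly that of the harmless base 1.
omit [MeasurableSpace Ω] in
lemma prodOneSub_simpleFunc (h : SimpleFunc E ℝ≥0∞) (U : ℕ → Ω → E) {ω : Ω}
    (hfin : ∀ c ∈ h.range, c ≠ 0 → pointMeasure U ω (h ⁻¹' {c}) < ∞) :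
    prodOneSub h (fun i => U i ω) =
      ∏ c ∈ h.range, (1 - c) ^ (pointMeasure U ω (h ⁻¹' {c})).toReal := by
  classical
  have hev : ∀ᶠ m in atTop, ∀ c ∈ h.range, (1 - c) ^ ((Finset.range m).filter
      fun i => h (U i ω) = c).card = (1 - c) ^ (pointMeasure U ω (h ⁻¹' {c})).toReal := by
    rw [eventually_all_finset]
    intro c hc
    rcases eq_or_ne c 0 with rfl | hc0
    · simp
    filter_upwards [eventually_card_eq_pointMeasure U (h.measurableSet_fiber c)
      (hfin c hc hc0)] with m hm
    rw [← hm, ENNReal.toReal_natCast, ENNReal.rpow_natCast]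
    simp only [Set.mem_preimage, Set.mem_singleton_iff]
  refine tendsto_nhds_unique
    (tendsto_atTop_iInf (antitone_prod_one_sub h fun i => U i ω)) ?_
  refine tendsto_const_nhds.congr' ?_
  filter_upwards [hev] with m hm
  rw [← Finset.prod_congr rfl hm, ← Finset.prod_fiberwise_of_maps_to
    (s := Finset.range m) (t := h.range) (g := fun i => h (U i ω))
    (fun i _ => h.mem_range_self _)]
  refine Finset.prod_congr rfl fun c _ => ?_
  rw [← Finset.prod_const]
  refine (Finset.prod_congr rfl fun i hi => ?_).symm
  rw [(Finset.mem_filter.1 hi).2]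

lemma lintegral_prodOneSub_simpleFunc {U : ℕ → Ω → E} {μ : Measure E} {P : Measure Ω}
    [IsProbabilityMeasure P] (hN : IsPoissonPointProcess (pointMeasure U) μ P)
    (h : SimpleFunc E ℝ≥0∞) (h1 : ∀ x, h x ≤ 1) (hint : ∫⁻ x, h x ∂μ ≠ ∞) :
    ∫⁻ ω, prodOneSub h (fun i => U i ω) ∂P =
      ENNReal.ofReal (Real.exp (-(∫⁻ x, h x ∂μ).toReal)) := by
  have hle : ∀ c ∈ h.range, c ≤ 1 := by
    intro c hc
    obtain ⟨x, rfl⟩ := SimpleFunc.mem_range.1 hc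
    exact h1 x
  have hsum : ∫⁻ x, h x ∂μ = ∑ c ∈ h.range, c * μ (h ⁻¹' {c}) := by
    rw [SimpleFunc.lintegral_eq_lintegral, SimpleFunc.lintegral]
  have hne : ∀ c ∈ h.range, c * μ (h ⁻¹' {c}) ≠ ∞ := by
    rw [hsum] at hint
    exact fun c hc => (ENNReal.sum_ne_top.1 hint) c hc
  have hμ : ∀ c ∈ h.range, c = 0 ∨ μ (h ⁻¹' {c}) < ∞ := by
    intro c hc
    rcases eq_or_ne c 0 with h0 | h0
    · exact Or.inl h0
    · refine Or.inr (lt_top_iff_ne_top.2 fun ht => hne c hc ?_)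
      rw [ht, ENNReal.mul_top h0]
  have hae : ∀ᵐ ω ∂P, ∀ c ∈ h.range, c ≠ 0 → pointMeasure U ω (h ⁻¹' {c}) < ∞ := by
    rw [Finset.eventually_all]
    intro c hc
    rcases hμ c hc with h0 | h0
    · simp [h0]
    · filter_upwards [hN.ae_count_lt_top (h.measurableSet_fiber c) h0] with ω hω _ using hω
  rw [lintegral_congr_ae (hae.mono fun ω hω => prodOneSub_simpleFunc h U hω)]
  -- Independence of the counts is available for families indexed by `Fin m`, so the values of `h`
  -- are enumerated.
  let e := h.range.equivFin.symm
  have hreindex : ∀ f : ℝ≥0∞ → ℝ≥0∞, ∏ c ∈ h.range, f c = ∏ j, f (e j) := by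
    intro f
    rw [← Finset.prod_coe_sort]
    exact (e.prod_comp fun c => f c).symm
  simp_rw [hreindex]
  have hind := hN.indep _ (fun j => h ⁻¹' {(e j : ℝ≥0∞)}) (fun j => h.measurableSet_fiber _) (by
    intro i j hij
    refine Disjoint.preimage _ (Set.disjoint_singleton.2 fun hc => hij ?_)
    exact e.injective (Subtype.ext hc))
  have hind' := hind.comp (fun j (x : ℝ≥0∞) => (1 - (e j : ℝ≥0∞)) ^ x.toReal)
    (fun j => by fun_prop)
  have hprod := lintegral_prod_eq_prod_lintegral_of_indepFun Finset.univ _ hind'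
    (fun j => by
      have := hN.measurable _ (h.measurableSet_fiber (e j : ℝ≥0∞))
      simp only [Function.comp_def]
      fun_prop)
  simp only [Function.comp_def] at hprod
  rw [hprod, Finset.prod_congr rfl fun j _ => lintegral_one_sub_rpow_count hN
      (h.measurableSet_fiber _) (hle _ (e j).2) (hμ _ (e j).2),
    ← ENNReal.ofReal_prod_of_nonneg fun _ _ => (Real.exp_pos _).le, ← Real.exp_sum, hsum,
    ENNReal.toReal_sum hne, Finset.sum_neg_distrib]
  congr 3
  rw [← Finset.sum_coe_sort h.range]
  exact e.sum_comp fun c => ((c : ℝ≥0∞) * μ (h ⁻¹' {(c : ℝ≥0∞)})).toReal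

/-- The Laplace functional of a Poisson process. -/
lemma lintegral_prodOneSub {U : ℕ → Ω → E} {μ : Measure E} {P : Measure Ω}
    [IsProbabilityMeasure P] (hU : ∀ i, Measurable (U i))
    (hN : IsPoissonPointProcess (pointMeasure U) μ P)
    {h : E → ℝ≥0∞} (hh : Measurable h) (h1 : ∀ x, h x ≤ 1) (hint : ∫⁻ x, h x ∂μ ≠ ∞) :
    ∫⁻ ω, prodOneSub h (fun i => U i ω) ∂P =
      ENNReal.ofReal (Real.exp (-(∫⁻ x, h x ∂μ).toReal)) := by
  let g := SimpleFunc.eapprox h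
  have hmono : Monotone g := SimpleFunc.monotone_eapprox h
  have hlim : ∀ x, Tendsto (fun n => g n x) atTop (𝓝 (h x)) := SimpleFunc.tendsto_eapprox hh
  have hgle : ∀ n x, g n x ≤ h x := fun n x =>
    Monotone.ge_of_tendsto (f := fun n => g n x) (fun a b hab => hmono hab x) (hlim x) n
  have hanti : ∀ (x : ℕ → E) m, Antitone fun n => ∏ i ∈ Finset.range m, (1 - g n (x i)) := by
    intro x m a b hab
    exact Finset.prod_le_prod' fun i _ => tsub_le_tsub_left (hmono hab (x i)) 1
  have hfinite : ∀ (x : ℕ → E) m, Tendsto (fun n => ∏ i ∈ Finset.range m, (1 - g n (x i))) atTop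
      (𝓝 (∏ i ∈ Finset.range m, (1 - h (x i)))) := by
    intro x m
    refine ENNReal.tendsto_finsetProd_of_ne_top _ (fun i _ => ?_) (fun i _ => ?_)
    · exact ENNReal.Tendsto.sub tendsto_const_nhds (hlim _) (Or.inl ENNReal.one_ne_top)
    · exact (tsub_le_self.trans_lt ENNReal.one_lt_top).ne
  have hanti' : ∀ x : ℕ → E, Antitone fun n => prodOneSub (g n) x := fun x a b hab =>
    iInf_mono fun m => hanti x m hab
  have hinf : ∀ x : ℕ → E, prodOneSub h x = ⨅ n, prodOneSub (g n) x := by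
    intro x
    unfold prodOneSub
    -- The products decrease both in the number of factors and in the approximation index, so both
    -- limits are infima and commute.
    rw [iInf_comm]
    exact iInf_congr fun m => (iInf_eq_of_tendsto (hanti x m) (hfinite x m)).symm
  have hL : Tendsto (fun n => ∫⁻ ω, prodOneSub (g n) (fun i => U i ω) ∂P) atTop
      (𝓝 (∫⁻ ω, prodOneSub h (fun i => U i ω) ∂P)) := by
    refine tendsto_lintegral_of_dominated_convergence (fun _ => 1)
      (fun n => measurable_prodOneSub (g n).measurable hU)
      (fun n => ae_of_all _ fun ω => prodOneSub_le_one _ _) (by simp)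
      (ae_of_all _ fun ω => ?_)
    rw [hinf]
    exact tendsto_atTop_iInf (hanti' _)
  have hI : Tendsto (fun n => ∫⁻ x, g n x ∂μ) atTop (𝓝 (∫⁻ x, h x ∂μ)) :=
    lintegral_tendsto_of_tendsto_of_monotone (fun n => (g n).aemeasurable)
      (ae_of_all _ fun x a b hab => hmono hab x) (ae_of_all _ hlim)
  refine tendsto_nhds_unique hL ?_
  have hne : ∀ n, ∫⁻ x, g n x ∂μ ≠ ∞ := fun n =>
    ne_top_of_le_ne_top hint (lintegral_mono (hgle n))
  simp_rw [fun n => lintegral_prodOneSub_simpleFunc hN (g n) (fun x => (hgle n x).trans (h1 x))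
    (hne n)]
  refine ENNReal.tendsto_ofReal ((Real.continuous_exp.tendsto _).comp ?_)
  exact ((ENNReal.tendsto_toReal hint).comp hI).neg

end PoissonLaplace

/-! ### The Poisson process with independent marks. -/

section MarkedPoints

lemma inverseSquareIntensity_Ioi {a : ℝ} (ha : 0 < a) :
    inverseSquareIntensity (Set.Ioi a) = ENNReal.ofReal (1 / a) := by
  have hfun : Set.EqOn (fun u : ℝ => u ^ (-2 : ℝ)) (fun u => 1 / u ^ 2) (Set.Ioi a) := by
    intro u hu
    have hu0 : 0 ≤ u := (ha.trans hu).le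
    simp only
    rw [Real.rpow_neg hu0, one_div]
    norm_num
  have hint : IntegrableOn (fun u : ℝ => 1 / u ^ 2) (Set.Ioi a) :=
    (integrableOn_Ioi_rpow_of_lt (by norm_num) ha).congr_fun hfun measurableSet_Ioi
  rw [inverseSquareIntensity, withDensity_apply _ measurableSet_Ioi,
    Measure.restrict_restrict measurableSet_Ioi,
    Set.inter_eq_left.2 (Set.Ioi_subset_Ioi ha.le),
    ← ofReal_integral_eq_lintegral_ofReal hint (ae_of_all _ fun u => by positivity),
    ← setIntegral_congr_fun measurableSet_Ioi hfun,
    integral_Ioi_rpow_of_lt (by norm_num) ha]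
  congr 1
  norm_num
  rw [Real.rpow_neg_one]

lemma inverseSquareIntensity_Iic_zero : inverseSquareIntensity (Set.Iic 0) = 0 := by
  rw [inverseSquareIntensity, withDensity_apply _ measurableSet_Iic,
    Measure.restrict_restrict measurableSet_Iic,
    (Set.Iic_disjoint_Ioi le_rfl).inter_eq]
  simp

instance : SFinite inverseSquareIntensity := by
  unfold inverseSquareIntensity
  infer_instance

lemma inverseSquareIntensity_lt_ofReal_mul {x : ℝ} (hx : 0 < x) {z : ℝ≥0∞} (hz : z ≠ ∞) :
    inverseSquareIntensity {u | ENNReal.ofReal x < ENNReal.ofReal u * z} =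
      z / ENNReal.ofReal x := by
  lift z to ℝ≥0 using hz
  rcases eq_or_ne z 0 with rfl | hz0
  · simp
  have hzpos : 0 < (z : ℝ) := by positivity
  have hset : {u | ENNReal.ofReal x < ENNReal.ofReal u * z} = Set.Ioi (x / z) := by
    ext u
    simp only [Set.mem_ofPred_eq, Set.mem_Ioi]
    rw [div_lt_iff₀ hzpos, ← ENNReal.ofReal_coe_nnreal, ← ENNReal.ofReal_mul' hzpos.le,
      ENNReal.ofReal_lt_ofReal_iff_of_nonneg hx.le]
  rw [hset, inverseSquareIntensity_Ioi (by positivity), one_div_div, ENNReal.ofReal_div_of_pos hx,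
    ENNReal.ofReal_coe_nnreal]

variable {Ω S : Type*} [MeasurableSpace Ω] [MeasurableSpace S]
  {P : Measure Ω} [IsProbabilityMeasure P]

-- The half-line `(-∞, 0]` has intensity 0, so its count is Poisson with mean 0 and none of the
-- Dirac masses charges it.
omit [IsProbabilityMeasure P] in
lemma ae_points_pos {U : ℕ → Ω → ℝ}
    (hN : IsPoissonPointProcess (pointMeasure U) inverseSquareIntensity P) :
    ∀ᵐ ω ∂P, ∀ i, 0 < U i ω := by
  have hlaw := hN.law_of_finite (Set.Iic 0) measurableSet_Iic (by
    simp [inverseSquareIntensity_Iic_zero])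
  have h0 : ∀ᵐ x ∂(P.map fun ω => pointMeasure U ω (Set.Iic 0)), x = 0 := by
    rw [hlaw, ae_map_iff (p := fun x : ℝ≥0∞ => x = 0) (by fun_prop) (measurableSet_singleton 0), poissonMeasure,
      inverseSquareIntensity_Iic_zero, ae_iff]
    rw [Measure.sum_apply _ (MeasurableSet.of_discrete), ENNReal.tsum_eq_zero]
    intro n
    rcases eq_or_ne n 0 with rfl | hn
    · simp
    · simp [hn]
  filter_upwards [ae_of_ae_map (hN.measurable _ measurableSet_Iic).aemeasurable h0] with ω hω i
  rw [pointMeasure, Measure.sum_apply _ measurableSet_Iic, ENNReal.tsum_eq_zero] at hω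
  have := hω i
  rw [Measure.dirac_apply' _ measurableSet_Iic] at this
  by_contra hi
  simp [not_lt.1 hi] at this

/-- Tonelli: for a fixed mark `s`, the points `u > x / ζ s` have intensity `ζ s / x`. -/
lemma lintegral_measure_lt_ofReal_mul {ν : Measure S} [IsProbabilityMeasure ν] {ζ : S → ℝ≥0∞}
    (hζ : Measurable ζ) (hint : ∫⁻ s, ζ s ∂ν ≠ ∞) {x : ℝ} (hx : 0 < x) :
    ∫⁻ u, ν {s | ENNReal.ofReal x < ENNReal.ofReal u * ζ s} ∂inverseSquareIntensity =
      (∫⁻ s, ζ s ∂ν) / ENNReal.ofReal x := by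
  have hmeas : MeasurableSet
      {p : ℝ × S | ENNReal.ofReal x < ENNReal.ofReal p.1 * ζ p.2} :=
    measurableSet_lt measurable_const (by fun_prop)
  have h1 := Measure.prod_apply (μ := inverseSquareIntensity) (ν := ν) hmeas
  have h2 := Measure.prod_apply_symm (μ := inverseSquareIntensity) (ν := ν) hmeas
  simp only [Set.preimage_ofPred_eq] at h1 h2
  rw [← h1, h2, div_eq_mul_inv, ← lintegral_mul_const _ hζ]
  refine lintegral_congr_ae ?_
  filter_upwards [ae_lt_top hζ hint] with s hs
  rw [inverseSquareIntensity_lt_ofReal_mul hx hs.ne, div_eq_mul_inv]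

/-- Given the points, the marks are still i.i.d. with law `ν`, so the conditional probability is a
product. -/
lemma measure_forall_lt_mul_le {U : ℕ → Ω → ℝ} {V : ℕ → Ω → S} {ν : Measure S}
    [IsProbabilityMeasure ν] (hU : ∀ i, Measurable (U i)) (hV : ∀ i, Measurable (V i))
    (hlaw : ∀ i, P.map (V i) = ν) (hind : iIndepFun V P)
    (hUV : IndepFun (fun ω i => U i ω) (fun ω i => V i ω) P)
    {ζ : S → ℝ≥0∞} (hζ : Measurable ζ) (c : ℝ≥0∞) (m : ℕ) :
    P {ω | ∀ i ∈ Finset.range m, ENNReal.ofReal (U i ω) * ζ (V i ω) ≤ c} =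
      ∫⁻ ω, ∏ i ∈ Finset.range m,
        (1 - ν {s | c < ENNReal.ofReal (U i ω) * ζ s}) ∂P := by
  have hUm : Measurable fun ω i => U i ω := measurable_pi_lambda _ hU
  have hVm : Measurable fun ω i => V i ω := measurable_pi_lambda _ hV
  have hC : ∀ a : ℝ, MeasurableSet {s | ENNReal.ofReal a * ζ s ≤ c} := fun a =>
    measurableSet_le (by fun_prop) measurable_const
  have hcompl : ∀ a : ℝ, 1 - ν {s | c < ENNReal.ofReal a * ζ s} =
      ν {s | ENNReal.ofReal a * ζ s ≤ c} := by
    intro a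
    rw [← prob_compl_eq_one_sub (measurableSet_lt measurable_const (by fun_prop))]
    congr 1
    ext s
    simp
  have hD : MeasurableSet {p : (ℕ → ℝ) × (ℕ → S) |
      ∀ i ∈ Finset.range m, ENNReal.ofReal (p.1 i) * ζ (p.2 i) ≤ c} := by
    simp only [Set.ofPred_forall]
    refine Finset.measurableSet_biInter _ fun i _ => measurableSet_le ?_ measurable_const
    fun_prop
  have hgm : Measurable fun a : ℝ => ν {s | ENNReal.ofReal a * ζ s ≤ c} := by
    have : MeasurableSet {p : ℝ × S | ENNReal.ofReal p.1 * ζ p.2 ≤ c} :=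
      measurableSet_le (by fun_prop) measurable_const
    exact measurable_measure_prodMk_left this
  have hjoint := hUV.map_prod_eq_prod_map_map hUm.aemeasurable hVm.aemeasurable
  calc P {ω | ∀ i ∈ Finset.range m, ENNReal.ofReal (U i ω) * ζ (V i ω) ≤ c}
      = P.map (fun ω => ((fun i => U i ω), (fun i => V i ω))) {p : (ℕ → ℝ) × (ℕ → S) |
          ∀ i ∈ Finset.range m, ENNReal.ofReal (p.1 i) * ζ (p.2 i) ≤ c} := by
        rw [Measure.map_apply (hUm.prodMk hVm) hD]
        rfl
    _ = ∫⁻ ω, P {ω' | ∀ i ∈ Finset.range m, ENNReal.ofReal (U i ω) * ζ (V i ω') ≤ c} ∂P := by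
        have : IsProbabilityMeasure (P.map fun ω i => V i ω) :=
          Measure.isProbabilityMeasure_map hVm.aemeasurable
        rw [hjoint, Measure.prod_apply hD,
          lintegral_map (measurable_measure_prodMk_left hD) hUm]
        refine lintegral_congr fun ω => ?_
        rw [Measure.map_apply hVm (measurable_prodMk_left hD)]
        rfl
    _ = _ := by
        refine lintegral_congr fun ω => ?_
        have hinter := hind.measure_inter_preimage_eq_mul (Finset.range m)
          (sets := fun i => {s | ENNReal.ofReal (U i ω) * ζ s ≤ c}) (fun i _ => hC _)
        have hset : {ω' | ∀ i ∈ Finset.range m, ENNReal.ofReal (U i ω) * ζ (V i ω') ≤ c} =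
            ⋂ i ∈ Finset.range m, V i ⁻¹' {s | ENNReal.ofReal (U i ω) * ζ s ≤ c} := by
          ext ω'
          simp
        rw [hset, hinter]
        refine Finset.prod_congr rfl fun i _ => ?_
        rw [hcompl, ← hlaw i, Measure.map_apply (hV i) (hC _)]

/-- The void probabilities of the marked Poisson process with intensity `u⁻² du` and
independent marks with law `ν`. -/
lemma measure_forall_mul_le {U : ℕ → Ω → ℝ} {V : ℕ → Ω → S} {ν : Measure S}
    [IsProbabilityMeasure ν] (hU : ∀ i, Measurable (U i)) (hV : ∀ i, Measurable (V i))
    (hlaw : ∀ i, P.map (V i) = ν) (hind : iIndepFun V P)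
    (hUV : IndepFun (fun ω i => U i ω) (fun ω i => V i ω) P)
    (hN : IsPoissonPointProcess (pointMeasure U) inverseSquareIntensity P)
    {ζ : S → ℝ≥0∞} (hζ : Measurable ζ) (hint : ∫⁻ s, ζ s ∂ν ≠ ∞) {x : ℝ} (hx : 0 < x) :
    P {ω | ∀ i, ENNReal.ofReal (U i ω) * ζ (V i ω) ≤ ENNReal.ofReal x} =
      ENNReal.ofReal (Real.exp (-((∫⁻ s, ζ s ∂ν).toReal / x))) := by
  set h : ℝ → ℝ≥0∞ := fun u => ν {s | ENNReal.ofReal x < ENNReal.ofReal u * ζ s}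
  have hh : Measurable h := by
    have : MeasurableSet {p : ℝ × S | ENNReal.ofReal x < ENNReal.ofReal p.1 * ζ p.2} :=
      measurableSet_lt measurable_const (by fun_prop)
    exact measurable_measure_prodMk_left this
  have hI : ∫⁻ u, h u ∂inverseSquareIntensity = (∫⁻ s, ζ s ∂ν) / ENNReal.ofReal x :=
    lintegral_measure_lt_ofReal_mul hζ hint hx
  have hset : {ω | ∀ i, ENNReal.ofReal (U i ω) * ζ (V i ω) ≤ ENNReal.ofReal x} =
      ⋂ m, {ω | ∀ i ∈ Finset.range m,
        ENNReal.ofReal (U i ω) * ζ (V i ω) ≤ ENNReal.ofReal x} := by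
    ext ω
    simp only [Set.mem_iInter, Set.mem_ofPred_eq]
    exact ⟨fun H m i _ => H i, fun H i => H (i + 1) i (by simp)⟩
  have hanti : Antitone fun m => {ω | ∀ i ∈ Finset.range m,
      ENNReal.ofReal (U i ω) * ζ (V i ω) ≤ ENNReal.ofReal x} := fun a b hab ω H i hi =>
    H i (Finset.range_mono hab hi)
  have hmeas : ∀ m, MeasurableSet {ω | ∀ i ∈ Finset.range m,
      ENNReal.ofReal (U i ω) * ζ (V i ω) ≤ ENNReal.ofReal x} := by
    intro m
    simp only [Set.ofPred_forall]
    exact Finset.measurableSet_biInter _ fun i _ => measurableSet_le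
      ((hU i).ennreal_ofReal.mul (hζ.comp (hV i))) measurable_const
  rw [hset, hanti.measure_iInter (fun m => (hmeas m).nullMeasurableSet)
    ⟨0, measure_ne_top _ _⟩]
  simp_rw [measure_forall_lt_mul_le hU hV hlaw hind hUV hζ]
  rw [← lintegral_iInf (f := fun m ω => ∏ i ∈ Finset.range m, (1 - h (U i ω)))
    (fun m => Finset.measurable_prod _ fun i _ => measurable_const.sub (hh.comp (hU i)))
    (fun a b hab ω => antitone_prod_one_sub h (fun i => U i ω) hab) (by simp)]
  -- The limit in `m` is the Laplace functional at `h u`, the probability that a point at `u`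
  -- receives a mark taking it above `x`.
  have := lintegral_prodOneSub hU hN hh (fun u => prob_le_one)
    (by rw [hI]; exact ENNReal.div_ne_top hint (by simpa using hx))
  rw [hI, ENNReal.toReal_div, ENNReal.toReal_ofReal hx.le] at this
  exact this

end MarkedPoints

/-! ### The spectral field of a Brown–Resnick field. -/

section SpectralFields

variable {k : ℕ} {Ω Ω' : Type*} [MeasurableSpace Ω] [MeasurableSpace Ω']

/-- The weight `exp (s(t) - v(t) / 2)` of a path `s` at the grid point `t`. -/
noncomputable def pathWeight (v : (Fin k → ℝ) → ℝ) (t : Fin k → ℤ) (s : (Fin k → ℝ) → ℝ) :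
    ℝ≥0∞ :=
  ENNReal.ofReal (Real.exp (s (gridPoint t) - v (gridPoint t) / 2))

@[fun_prop]
lemma measurable_pathWeight (v : (Fin k → ℝ) → ℝ) (t : Fin k → ℤ) :
    Measurable (pathWeight v t) := by
  unfold pathWeight
  fun_prop

lemma measurable_sup_pathWeight (v : (Fin k → ℝ) → ℝ) (A : Finset (Fin k → ℤ)) :
    Measurable fun s => A.sup fun t => pathWeight v t s := by
  simp_rw [Finset.sup_eq_iSup]
  exact Measurable.iSup fun t => Measurable.iSup fun _ => measurable_pathWeight v t

/-- The spectral field `exp (W(t) - σ²(t) / 2)` of a Brown–Resnick field. -/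
noncomputable def spectralField (W : (Fin k → ℝ) → Ω' → ℝ) (P' : Measure Ω')
    (t : Fin k → ℤ) (ω : Ω') : ℝ≥0∞ :=
  pathWeight (fun s => variance (W s) P') t fun s => W s ω

lemma spectralField_pos (W : (Fin k → ℝ) → Ω' → ℝ) (P' : Measure Ω') (t : Fin k → ℤ)
    (ω : Ω') : 0 < spectralField W P' t ω := by
  simp [spectralField, pathWeight, Real.exp_pos]

variable {W : (Fin k → ℝ) → Ω' → ℝ} {P' : Measure Ω'}

namespace IsStationaryIncrementGaussianField

lemma measurable_spectralField (hW : IsStationaryIncrementGaussianField W P') (t : Fin k → ℤ) :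
    Measurable (spectralField W P' t) :=
  (measurable_pathWeight _ t).comp (measurable_pi_lambda _ hW.measurable)

lemma measurable_sup_spectralField (hW : IsStationaryIncrementGaussianField W P')
    (A : Finset (Fin k → ℤ)) : Measurable fun ω => A.sup fun t => spectralField W P' t ω :=
  (measurable_sup_pathWeight _ A).comp (measurable_pi_lambda _ hW.measurable)

lemma lintegral_spectralField [IsProbabilityMeasure P']
    (hW : IsStationaryIncrementGaussianField W P') (t : Fin k → ℤ) :
    ∫⁻ ω, spectralField W P' t ω ∂P' = 1 := by
  have hg : HasGaussianLaw (W (gridPoint t)) P' :=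
    (hW.gaussian.hasGaussianLaw {gridPoint t}).eval ⟨gridPoint t, by simp⟩
  have hmap := hg.map_eq_gaussianReal
  rw [hW.zero_mean] at hmap
  have hmgf := mgf_gaussianReal hmap 1
  simp only [mgf, one_mul, zero_add, one_pow, mul_one,
    Real.coe_toNNReal _ (variance_nonneg _ _)] at hmgf
  -- The integral of a non-integrable function is 0 by convention, whereas the Gaussian moment
  -- generating function is positive.
  have hexp : Integrable (fun ω => Real.exp (W (gridPoint t) ω)) P' := by
    by_contra hni
    rw [integral_undef hni] at hmgf
    exact (Real.exp_pos _).ne hmgf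
  have hform : ∀ ω, spectralField W P' t ω = ENNReal.ofReal
      (Real.exp (W (gridPoint t) ω) / Real.exp (variance (W (gridPoint t)) P' / 2)) := by
    intro ω
    rw [← Real.exp_sub]
    rfl
  simp_rw [hform]
  rw [← ofReal_integral_eq_lintegral_ofReal (hexp.div_const _)
    (ae_of_all _ fun ω => by positivity), integral_div, hmgf, div_self (Real.exp_pos _).ne',
    ENNReal.ofReal_one]

lemma lintegral_sup_spectralField_le [IsProbabilityMeasure P']
    (hW : IsStationaryIncrementGaussianField W P') (A : Finset (Fin k → ℤ)) :
    ∫⁻ ω, (A.sup fun t => spectralField W P' t ω) ∂P' ≤ A.card := by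
  calc ∫⁻ ω, (A.sup fun t => spectralField W P' t ω) ∂P'
      ≤ ∫⁻ ω, ∑ t ∈ A, spectralField W P' t ω ∂P' :=
        lintegral_mono fun ω => Finset.sup_le fun t ht =>
          Finset.single_le_sum (f := fun t => spectralField W P' t ω) (fun _ _ => zero_le) ht
    _ = A.card := by
        rw [lintegral_finsetSum _ fun t _ => hW.measurable_spectralField t]
        simp [hW.lintegral_spectralField]

end IsStationaryIncrementGaussianField

end SpectralFields

/-! ### Fréchet tails of maxima over finite sets. -/

section BrownResnickTails

variable {k : ℕ} {Ω Ω' : Type*} [MeasurableSpace Ω] [MeasurableSpace Ω']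
  {P : Measure Ω} {P' : Measure Ω'} {W : (Fin k → ℝ) → Ω' → ℝ}
  {Wc : ℕ → (Fin k → ℝ) → Ω → ℝ} {U : ℕ → Ω → ℝ}

omit [MeasurableSpace Ω] in
lemma lt_fieldMax_iff {E : Type*} [NormedAddCommGroup E] {X : (Fin k → ℤ) → Ω → E}
    {A : Finset (Fin k → ℤ)} {ω : Ω} {x : ℝ} (hx : 0 ≤ x) :
    x < fieldMax X A ω ↔ ∃ t ∈ A, x < ‖X t ω‖ := by
  lift x to ℝ≥0 using hx
  simp only [fieldMax, NNReal.coe_lt_coe, Finset.lt_sup_iff, ← coe_nnnorm]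

lemma measurableSet_lt_fieldMax {X : (Fin k → ℤ) → Ω → ℝ} (hX : ∀ t, Measurable (X t))
    (A : Finset (Fin k → ℤ)) {x : ℝ} (hx : 0 ≤ x) :
    MeasurableSet {ω | x < fieldMax X A ω} := by
  have : {ω | x < fieldMax X A ω} = ⋃ t ∈ A, {ω | x < ‖X t ω‖} := by
    ext ω
    simp [lt_fieldMax_iff hx]
  rw [this]
  exact Finset.measurableSet_biUnion _ fun t _ => measurableSet_lt measurable_const (hX t).norm

lemma ofReal_mul_pathWeight (v : (Fin k → ℝ) → ℝ) (t : Fin k → ℤ) (s : (Fin k → ℝ) → ℝ)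
    (u : ℝ) : ENNReal.ofReal u * pathWeight v t s =
      ENNReal.ofReal (u * Real.exp (s (gridPoint t) - v (gridPoint t) / 2)) := by
  rw [pathWeight, ENNReal.ofReal_mul' (Real.exp_pos _).le]

lemma ofReal_mul_sup_pathWeight_le_iff (v : (Fin k → ℝ) → ℝ) (A : Finset (Fin k → ℤ))
    (s : (Fin k → ℝ) → ℝ) (u : ℝ) {x : ℝ} (hx : 0 ≤ x) :
    ENNReal.ofReal u * (A.sup fun t => pathWeight v t s) ≤ ENNReal.ofReal x ↔
      ∀ t ∈ A, u * Real.exp (s (gridPoint t) - v (gridPoint t) / 2) ≤ x := by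
  have hsup : ENNReal.ofReal u * (A.sup fun t => pathWeight v t s) =
      A.sup fun t => ENNReal.ofReal u * pathWeight v t s := by
    simp_rw [Finset.sup_eq_iSup, ENNReal.mul_iSup]
  rw [hsup, Finset.sup_le_iff]
  simp_rw [ofReal_mul_pathWeight, ENNReal.ofReal_le_ofReal_iff hx]

namespace IsBrownResnickInput

lemma measurable_brownResnickField (hin : IsBrownResnickInput W P' Wc U P)
    (v : (Fin k → ℝ) → ℝ) (t : Fin k → ℝ) : Measurable (brownResnickField U Wc v t) := by
  unfold brownResnickField
  refine Measurable.iSup fun i => ?_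
  have h1 := hin.measurable_points i
  have h2 := hin.measurable_copies i t
  fun_prop

variable [IsProbabilityMeasure P] [IsProbabilityMeasure P']

/-- The marks are the whole paths, and `ζ` is the maximal weight of a path over `A`. -/
lemma measure_forall_mul_sup_le (hW : IsStationaryIncrementGaussianField W P')
    (hin : IsBrownResnickInput W P' Wc U P) (A : Finset (Fin k → ℤ)) {x : ℝ} (hx : 0 < x) :
    P {ω | ∀ i, ∀ t ∈ A, U i ω * Real.exp (Wc i (gridPoint t) ω -
        variance (W (gridPoint t)) P' / 2) ≤ x} =
      ENNReal.ofReal (Real.exp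
        (-((∫⁻ ω, (A.sup fun t => spectralField W P' t ω) ∂P').toReal / x))) := by
  have hWm : Measurable fun ω t => W t ω := measurable_pi_lambda _ hW.measurable
  have : IsProbabilityMeasure (P'.map fun ω t => W t ω) :=
    Measure.isProbabilityMeasure_map hWm.aemeasurable
  have hζ := measurable_sup_pathWeight (fun s => variance (W s) P') A
  have hI : ∫⁻ s, (A.sup fun t => pathWeight (fun s => variance (W s) P') t s)
      ∂(P'.map fun ω t => W t ω) = ∫⁻ ω, (A.sup fun t => spectralField W P' t ω) ∂P' :=
    lintegral_map hζ hWm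
  have hmain := measure_forall_mul_le (V := fun i ω t => Wc i t ω) hin.measurable_points
    (fun i => measurable_pi_lambda _ (hin.measurable_copies i))
    (fun i => (hin.copies i).map_eq) hin.indep_copies hin.indep_points hin.poisson hζ
    (by rw [hI]; exact ne_top_of_le_ne_top (ENNReal.natCast_ne_top _)
          (hW.lintegral_sup_spectralField_le A)) hx
  rw [hI] at hmain
  rw [← hmain]
  congr 1
  ext ω
  refine forall_congr' fun i => ?_
  exact (ofReal_mul_sup_pathWeight_le_iff (fun s => variance (W s) P') A
    (fun t => Wc i t ω) _ hx.le).symm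

/-- A real supremum of an unbounded family is 0 by convention, so boundedness has to be known before
`X t ≤ x` can be read pointwise. It holds with probability at least `exp (-θ / (n + 1))` for every
`n`. -/
lemma ae_bddAbove (hW : IsStationaryIncrementGaussianField W P')
    (hin : IsBrownResnickInput W P' Wc U P) (t : Fin k → ℤ) :
    ∀ᵐ ω ∂P, BddAbove (Set.range fun i => U i ω * Real.exp (Wc i (gridPoint t) ω -
        variance (W (gridPoint t)) P' / 2)) := by
  set B := {ω | BddAbove (Set.range fun i => U i ω * Real.exp (Wc i (gridPoint t) ω -
        variance (W (gridPoint t)) P' / 2))}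
  have hle : ∀ n : ℕ, ENNReal.ofReal (Real.exp (-(((∫⁻ ω,
      (({t} : Finset (Fin k → ℤ)).sup fun t => spectralField W P' t ω) ∂P').toReal) /
        ((n : ℝ) + 1)))) ≤ P B := by
    intro n
    rw [← measure_forall_mul_sup_le hW hin {t} (by positivity : (0 : ℝ) < (n : ℝ) + 1)]
    refine measure_mono fun ω hω => ⟨(n : ℝ) + 1, ?_⟩
    rintro _ ⟨i, rfl⟩
    exact hω i t (by simp)
  have hlim : Tendsto (fun n : ℕ => ENNReal.ofReal (Real.exp (-(((∫⁻ ω,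
      (({t} : Finset (Fin k → ℤ)).sup fun t => spectralField W P' t ω) ∂P').toReal) /
        ((n : ℝ) + 1))))) atTop (𝓝 1) := by
    have h0 := ((tendsto_const_nhds (x := (∫⁻ ω, (({t} : Finset (Fin k → ℤ)).sup fun t =>
      spectralField W P' t ω) ∂P').toReal)).div_atTop
      (tendsto_atTop_add_const_right _ (1 : ℝ) tendsto_natCast_atTop_atTop)).neg
    have := ENNReal.tendsto_ofReal ((Real.continuous_exp.tendsto _).comp h0)
    simpa using this
  have hB : MeasurableSet B := by
    refine measurableSet_bddAbove_range fun i => ?_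
    have h1 := hin.measurable_points i
    have h2 := hin.measurable_copies i (gridPoint t)
    fun_prop
  exact (mem_ae_iff_prob_eq_one hB).2 (le_antisymm prob_le_one (le_of_tendsto' hlim hle))

lemma measureReal_lt_fieldMax (hW : IsStationaryIncrementGaussianField W P')
    (hin : IsBrownResnickInput W P' Wc U P) (A : Finset (Fin k → ℤ)) {x : ℝ} (hx : 0 < x) :
    P.real {ω | x < fieldMax (fun t => brownResnickField U Wc
        (fun s => variance (W s) P') (gridPoint t)) A ω} =
      1 - Real.exp (-((∫⁻ ω, (A.sup fun t => spectralField W P' t ω) ∂P').toReal / x)) := by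
  set X : (Fin k → ℤ) → Ω → ℝ := fun t => brownResnickField U Wc
    (fun s => variance (W s) P') (gridPoint t)
  have hXm : ∀ t, Measurable (X t) := fun t => hin.measurable_brownResnickField _ _
  have hm := measurableSet_lt_fieldMax hXm A hx.le
  have hae : P.real {ω | x < fieldMax X A ω}ᶜ = P.real {ω | ∀ i, ∀ t ∈ A,
      U i ω * Real.exp (Wc i (gridPoint t) ω - variance (W (gridPoint t)) P' / 2) ≤ x} := by
    refine measureReal_congr (eventuallyEq_set.2 ?_)
    filter_upwards [ae_points_pos hin.poisson, ae_all_iff.2 (ae_bddAbove hW hin)] with ω hpos hbdd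
    simp only [Set.mem_compl_iff, Set.mem_ofPred_eq, lt_fieldMax_iff hx.le, not_exists, not_and,
      not_lt]
    rw [forall_comm]
    refine forall_congr' fun t => ?_
    rw [forall_comm]
    refine forall_congr' fun _ => ?_
    have hnn : 0 ≤ X t ω := Real.iSup_nonneg fun i =>
      mul_nonneg (hpos i).le (Real.exp_pos _).le
    rw [Real.norm_of_nonneg hnn]
    exact ciSup_le_iff (hbdd t)
  have hcompl := measureReal_compl (μ := P) hm
  rw [probReal_univ, hae, measureReal_def,
    measure_forall_mul_sup_le hW hin A hx, ENNReal.toReal_ofReal (Real.exp_pos _).le] at hcompl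
  linarith

end IsBrownResnickInput

end BrownResnickTails

/-! ### Hypercubes and block arrays. -/

section Hypercubes

variable {k : ℕ}

lemma mem_hypercube {n : Fin k → ℕ} {t : Fin k → ℤ} :
    t ∈ hypercube n ↔ ∀ l, (t l).natAbs < n l := by
  simp only [hypercube, Finset.mem_Icc, Pi.le_def, ← forall_and]
  refine forall_congr' fun l => ?_
  omega

lemma hypercube_mono {m n : Fin k → ℕ} (h : m ≤ n) : hypercube m ⊆ hypercube n := fun _ ht =>
  mem_hypercube.2 fun l => (mem_hypercube.1 ht l).trans_le (h l)

lemma eventually_mem_hypercube (t : Fin k → ℤ) : ∀ᶠ n in atTop, t ∈ hypercube n := by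
  filter_upwards [eventually_ge_atTop fun l => (t l).natAbs + 1] with n hn
  exact mem_hypercube.2 fun l => hn l

lemma tendsto_const_pi_atTop : Tendsto (fun (M : ℕ) (_ : Fin k) => M) atTop atTop :=
  tendsto_atTop.2 fun b => by
    filter_upwards [eventually_ge_atTop (Finset.univ.sup b)] with M hM l
    exact (Finset.le_sup (Finset.mem_univ l)).trans hM

lemma card_hypercube_le (n : Fin k → ℕ) : ((hypercube n).card : ℝ) ≤ ∏ l, (2 * (n l : ℝ)) := by
  have h : (hypercube n).card ≤ ∏ l, (2 * n l) := by
    rw [hypercube, Pi.card_Icc]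
    refine Finset.prod_le_prod' fun l _ => ?_
    rw [Int.card_Icc]
    omega
  exact_mod_cast h

lemma tendsto_prod_natCast_atTop (hk : 0 < k) :
    Tendsto (fun n : Fin k → ℕ => ∏ l, (n l : ℝ)) atTop atTop := by
  have h1 : Tendsto (fun n : Fin k → ℕ => (n ⟨0, hk⟩ : ℝ)) atTop atTop :=
    tendsto_natCast_atTop_atTop.comp (tendsto_atTop.2 fun b => by
      filter_upwards [eventually_ge_atTop fun _ : Fin k => b] with n hn using hn _)
  refine tendsto_atTop_mono' _ ?_ h1
  filter_upwards [eventually_ge_atTop (1 : Fin k → ℕ)] with n hn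
  have h : n ⟨0, hk⟩ ≤ ∏ l, n l :=
    Finset.single_le_prod' (f := n) (fun l _ => hn l) (Finset.mem_univ _)
  exact_mod_cast h

lemma isBlockArray_sqrt : IsBlockArray fun (n : Fin k → ℕ) l => (n l).sqrt where
  mono := fun a b hab l => Nat.sqrt_le_sqrt (hab l)
  tendsto_atTop := tendsto_atTop.2 fun b => by
    filter_upwards [eventually_ge_atTop fun l => b l * b l] with n hn l
    exact Nat.le_sqrt.2 (hn l)
  negligible := fun l => by
    have hn : Tendsto (fun n : Fin k → ℕ => n l) atTop atTop := tendsto_atTop.2 fun b => by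
      filter_upwards [eventually_ge_atTop fun _ : Fin k => b] with n hn using hn l
    have hlim : Tendsto (fun m : ℕ => (Real.sqrt m)⁻¹) atTop (𝓝 0) :=
      tendsto_inv_atTop_zero.comp (Real.tendsto_sqrt_atTop.comp tendsto_natCast_atTop_atTop)
    refine squeeze_zero (fun n => by positivity) (fun n => ?_) (hlim.comp hn)
    rw [Function.comp_apply, ← Real.sqrt_div_self]
    gcongr
    exact Real.nat_sqrt_le_real_sqrt

end Hypercubes

/-! ### Elementary bounds for the conditional probability. -/

section TailRatios

lemma le_exp_mul_one_sub_exp_neg (y : ℝ) : y ≤ Real.exp y * (1 - Real.exp (-y)) := by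
  rw [mul_sub, ← Real.exp_add, add_neg_cancel, Real.exp_zero, mul_one]
  linarith [Real.add_one_le_exp y]

/-- Convexity of `exp` between `-y` and 0. -/
lemma mul_one_sub_exp_neg_le {c y : ℝ} (h0 : 0 ≤ c) (h1 : c ≤ 1) :
    (1 - c) * (1 - Real.exp (-y)) ≤ 1 - Real.exp (-((1 - c) * y)) := by
  have h := convexOn_exp.2 (Set.mem_univ (-y)) (Set.mem_univ 0) (sub_nonneg.2 h1) h0
    (sub_add_cancel 1 c)
  simp only [smul_eq_mul, mul_zero, add_zero, Real.exp_zero, mul_one, mul_neg] at h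
  linarith

/-- The numerator is `(1 - e^{-y}) - e^{-ay} (1 - e^{-(1-c)y})`. Convexity and `e^{-ay} ≥ 1 - ay`
bound the ratio by `1 - (1 - ay)(1 - c)`. -/
lemma tail_ratio_le {a c y : ℝ} (ha : 0 ≤ a) (h0 : 0 ≤ c) (h1 : c ≤ 1) (hy : 0 < y) :
    ((1 - Real.exp (-y)) + (1 - Real.exp (-(a * y))) - (1 - Real.exp (-((a + 1 - c) * y)))) /
      (1 - Real.exp (-y)) ≤ c + a * y := by
  have hp : 0 < 1 - Real.exp (-y) := by simpa using hy
  rw [div_le_iff₀ hp, show -((a + 1 - c) * y) = -(a * y) + -((1 - c) * y) by ring, Real.exp_add]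
  have hconv := mul_one_sub_exp_neg_le (y := y) h0 h1
  have he : 1 - a * y ≤ Real.exp (-(a * y)) := by linarith [Real.add_one_le_exp (-(a * y))]
  have hcp : 0 ≤ (1 - c) * (1 - Real.exp (-y)) := mul_nonneg (sub_nonneg.2 h1) hp.le
  have h2 := mul_le_mul_of_nonneg_left hconv (Real.exp_pos (-(a * y))).le
  have h3 := mul_le_mul_of_nonneg_right he hcp
  have h4 : 0 ≤ c * (a * y) * (1 - Real.exp (-y)) := by positivity
  linarith

/-- In the same numerator, `e^{-ay} ≤ 1` and `1 - e^{-(1-c)y} ≤ (1-c) y ≤ (1-c) e^y (1 - e^{-y})`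
give the lower bound `1 - (1-c) e^y`. This error does not involve `a`. -/
lemma le_tail_ratio {a c y : ℝ} (ha : 0 ≤ a) (h0 : 0 ≤ c) (h1 : c ≤ 1) (hy : 0 < y) :
    c - (Real.exp y - 1) ≤
    ((1 - Real.exp (-y)) + (1 - Real.exp (-(a * y))) - (1 - Real.exp (-((a + 1 - c) * y)))) /
      (1 - Real.exp (-y)) := by
  have hp : 0 < 1 - Real.exp (-y) := by simpa using hy
  rw [le_div_iff₀ hp, show -((a + 1 - c) * y) = -(a * y) + -((1 - c) * y) by ring, Real.exp_add]
  have hc : 0 ≤ 1 - c := sub_nonneg.2 h1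
  have hq : 0 ≤ 1 - Real.exp (-((1 - c) * y)) := by
    simpa using mul_nonneg hc hy.le
  have he : Real.exp (-(a * y)) ≤ 1 := by simpa using mul_nonneg ha hy.le
  have hlin : 1 - Real.exp (-((1 - c) * y)) ≤ (1 - c) * y := by
    linarith [Real.add_one_le_exp (-((1 - c) * y))]
  have h2 := mul_le_mul_of_nonneg_right he hq
  have h3 := mul_le_mul_of_nonneg_left (le_exp_mul_one_sub_exp_neg y) hc
  have h4 : 0 ≤ c * (Real.exp y - 1) * (1 - Real.exp (-y)) := by
    have : 1 ≤ Real.exp y := by simpa using hy.le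
    exact mul_nonneg (mul_nonneg h0 (sub_nonneg.2 this)) hp.le
  linarith

end TailRatios

/-! ### The limiting cluster functional. -/

section SpectralLimits

variable {k : ℕ} {Ω' : Type*} [MeasurableSpace Ω'] {P' : Measure Ω'} [IsProbabilityMeasure P']
  {W : (Fin k → ℝ) → Ω' → ℝ}

/-- The supremum of the spectral field outside of the hypercube `R_{(M,…,M)}`. -/
noncomputable def tailSup (W : (Fin k → ℝ) → Ω' → ℝ) (P' : Measure Ω') (M : ℕ) (ω : Ω') :
    ℝ≥0∞ :=
  ⨆ t ∉ hypercube fun _ => M, spectralField W P' t ω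

/-- The limit of the conditional probabilities in the anti-clustering condition. -/
noncomputable def clusterLimit (W : (Fin k → ℝ) → Ω' → ℝ) (P' : Measure Ω') (M : ℕ) : ℝ≥0∞ :=
  ∫⁻ ω, tailSup W P' M ω ⊓ spectralField W P' 0 ω ∂P'

omit [IsProbabilityMeasure P'] in
lemma antitone_tailSup (ω : Ω') : Antitone fun M => tailSup W P' M ω := fun _ _ hab =>
  biSup_mono fun _ ht h => ht (hypercube_mono (fun _ => hab) h)

omit [IsProbabilityMeasure P'] in
lemma tendsto_sup_spectralField {r : (Fin k → ℕ) → (Fin k → ℕ)} (hr : Tendsto r atTop atTop)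
    (M : ℕ) (ω : Ω') :
    Tendsto (fun n => (hypercube (r n) \ hypercube fun _ => M).sup
      fun t => spectralField W P' t ω) atTop (𝓝 (tailSup W P' M ω)) := by
  refine tendsto_order.2 ⟨fun b hb => ?_, fun b hb => Eventually.of_forall fun n => ?_⟩
  · obtain ⟨t, ht⟩ := lt_iSup_iff.1 hb
    obtain ⟨htM, hbt⟩ := lt_iSup_iff.1 ht
    filter_upwards [hr.eventually (eventually_mem_hypercube t)] with n hn
    exact hbt.trans_le (Finset.le_sup (f := fun t => spectralField W P' t ω)
      (Finset.mem_sdiff.2 ⟨hn, htM⟩))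
  · refine lt_of_le_of_lt (Finset.sup_le fun t ht => ?_) hb
    exact le_iSup₂ (f := fun t (_ : t ∉ hypercube fun _ => M) => spectralField W P' t ω) t
      (Finset.mem_sdiff.1 ht).2

omit [IsProbabilityMeasure P'] in
lemma iInf_tailSup_eq_zero_iff (ω : Ω') : ⨅ M, tailSup W P' M ω = 0 ↔
    Tendsto (fun t : Fin k → ℤ => W (gridPoint t) ω - variance (W (gridPoint t)) P' / 2)
      cofinite atBot := by
  constructor
  · intro h
    refine tendsto_atBot.2 fun b => ?_
    have hpos : ⨅ M, tailSup W P' M ω < ENNReal.ofReal (Real.exp b) := by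
      rw [h]
      simp [Real.exp_pos]
    obtain ⟨M, hM⟩ := iInf_lt_iff.1 hpos
    filter_upwards [(hypercube fun _ : Fin k => M).eventually_cofinite_notMem] with t ht
    have hle : spectralField W P' t ω ≤ ENNReal.ofReal (Real.exp b) :=
      (le_iSup₂ (f := fun t (_ : t ∉ hypercube fun _ => M) => spectralField W P' t ω)
        t ht).trans hM.le
    rw [spectralField, pathWeight, ENNReal.ofReal_le_ofReal_iff (Real.exp_pos b).le,
      Real.exp_le_exp] at hle
    exact hle
  · intro h
    refine le_antisymm (ENNReal.le_of_forall_pos_le_add fun ε hε _ => ?_) zero_le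
    rw [zero_add]
    have hfin : {t | ¬ W (gridPoint t) ω - variance (W (gridPoint t)) P' / 2 ≤
        Real.log ε}.Finite := h.eventually (eventually_le_atBot (Real.log ε))
    have hev : ∀ᶠ M : ℕ in atTop, ∀ t ∈ hfin.toFinset, t ∈ hypercube fun _ : Fin k => M := by
      rw [eventually_all_finset]
      exact fun t _ => tendsto_const_pi_atTop.eventually (eventually_mem_hypercube t)
    obtain ⟨M, hM⟩ := hev.exists
    refine (iInf_le _ M).trans (iSup₂_le fun t ht => ?_)
    have hle : W (gridPoint t) ω - variance (W (gridPoint t)) P' / 2 ≤ Real.log ε := by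
      by_contra hcon
      exact ht (hM t (hfin.mem_toFinset.2 hcon))
    rw [spectralField, pathWeight, ← ENNReal.ofReal_coe_nnreal]
    refine ENNReal.ofReal_le_ofReal ?_
    rw [← Real.exp_log (NNReal.coe_pos.2 hε)]
    exact Real.exp_le_exp.2 hle

namespace IsStationaryIncrementGaussianField

omit [IsProbabilityMeasure P'] in
lemma measurable_tailSup (hW : IsStationaryIncrementGaussianField W P') (M : ℕ) :
    Measurable (tailSup W P' M) := by
  unfold tailSup
  exact Measurable.iSup fun t => Measurable.iSup fun _ => hW.measurable_spectralField t

lemma tendsto_lintegral_sup_inf (hW : IsStationaryIncrementGaussianField W P')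
    {r : (Fin k → ℕ) → (Fin k → ℕ)} (hr : Tendsto r atTop atTop) (M : ℕ) :
    Tendsto (fun n => ∫⁻ ω, ((hypercube (r n) \ hypercube fun _ => M).sup
      fun t => spectralField W P' t ω) ⊓ spectralField W P' 0 ω ∂P') atTop
      (𝓝 (clusterLimit W P' M)) := by
  refine tendsto_lintegral_filter_of_dominated_convergence (spectralField W P' 0)
    (Eventually.of_forall fun n =>
      (hW.measurable_sup_spectralField _).inf (hW.measurable_spectralField 0))
    (Eventually.of_forall fun n => ae_of_all _ fun ω => inf_le_right)
    (by simp [hW.lintegral_spectralField]) (ae_of_all _ fun ω => ?_)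
  exact (tendsto_sup_spectralField hr M ω).inf_nhds tendsto_const_nhds

/-- Dominated convergence, with the integrable bound `Y(0)`, moves the limit in `M` inside; since
`Y(0) > 0`, the minimum vanishes only if the tail supremum does. -/
lemma tendsto_clusterLimit_zero_iff (hW : IsStationaryIncrementGaussianField W P') :
    Tendsto (clusterLimit W P') atTop (𝓝 0) ↔
      ∀ᵐ ω ∂P', Tendsto (fun t : Fin k → ℤ =>
        W (gridPoint t) ω - variance (W (gridPoint t)) P' / 2) cofinite atBot := by
  have hanti : ∀ ω, Antitone fun M => tailSup W P' M ω ⊓ spectralField W P' 0 ω :=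
    fun ω a b hab => inf_le_inf_right _ (antitone_tailSup ω hab)
  have hmeas : ∀ M, Measurable fun ω => tailSup W P' M ω ⊓ spectralField W P' 0 ω :=
    fun M => (hW.measurable_tailSup M).inf (hW.measurable_spectralField 0)
  have hlim : Tendsto (clusterLimit W P') atTop
      (𝓝 (∫⁻ ω, ⨅ M, tailSup W P' M ω ⊓ spectralField W P' 0 ω ∂P')) := by
    refine tendsto_lintegral_of_dominated_convergence (spectralField W P' 0) hmeas
      (fun M => ae_of_all _ fun ω => inf_le_right)
      (by simp [hW.lintegral_spectralField]) (ae_of_all _ fun ω => ?_)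
    exact tendsto_atTop_iInf (hanti ω)
  have hiff : Tendsto (clusterLimit W P') atTop (𝓝 0) ↔
      ∫⁻ ω, ⨅ M, tailSup W P' M ω ⊓ spectralField W P' 0 ω ∂P' = 0 :=
    ⟨fun h => tendsto_nhds_unique hlim h, fun h => h ▸ hlim⟩
  rw [hiff, lintegral_eq_zero_iff (Measurable.iInf hmeas)]
  refine eventually_congr (ae_of_all _ fun ω => ?_)
  rw [← iInf_tailSup_eq_zero_iff]
  simp only [Pi.zero_apply]
  rw [← iInf_inf, ← bot_eq_zero (α := ℝ≥0∞), min_eq_bot]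
  exact or_iff_left (spectralField_pos W P' 0 ω).ne'

end IsStationaryIncrementGaussianField

end SpectralLimits

/-! ### Conditional exceedance probabilities and their limits. -/

section ConditionalTails

variable {k : ℕ} {Ω Ω' : Type*} [MeasurableSpace Ω] [MeasurableSpace Ω']
  {P : Measure Ω} {P' : Measure Ω'} [IsProbabilityMeasure P] [IsProbabilityMeasure P']
  {W : (Fin k → ℝ) → Ω' → ℝ} {Wc : ℕ → (Fin k → ℝ) → Ω → ℝ} {U : ℕ → Ω → ℝ}
  {X : (Fin k → ℤ) → Ω → ℝ}

namespace IsBrownResnickInput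

lemma measureReal_lt_norm (hW : IsStationaryIncrementGaussianField W P')
    (hin : IsBrownResnickInput W P' Wc U P)
    (hX : X = fun t => brownResnickField U Wc (fun s => variance (W s) P') (gridPoint t))
    (t : Fin k → ℤ) {x : ℝ} (hx : 0 < x) :
    P.real {ω | x < ‖X t ω‖} = 1 - Real.exp (-(1 / x)) := by
  have h := hin.measureReal_lt_fieldMax hW {t} hx
  rw [← hX] at h
  simpa [lt_fieldMax_iff hx.le, hW.lintegral_spectralField] using h

lemma cond_lt_fieldMax_bounds (hW : IsStationaryIncrementGaussianField W P')
    (hin : IsBrownResnickInput W P' Wc U P)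
    (hX : X = fun t => brownResnickField U Wc (fun s => variance (W s) P') (gridPoint t))
    (A : Finset (Fin k → ℤ)) {x : ℝ} (hx : 0 < x) :
    let c := (∫⁻ ω, (A.sup fun t => spectralField W P' t ω) ⊓ spectralField W P' 0 ω ∂P').toReal
    let p := (cond P {ω | x < ‖X 0 ω‖} {ω | x < fieldMax X A ω}).toReal
    c - (Real.exp (1 / x) - 1) ≤ p ∧ p ≤ c + A.card / x := by
  intro c p
  have hXm : ∀ t, Measurable (X t) := fun t => by
    rw [hX]
    exact hin.measurable_brownResnickField _ _
  set θ : Finset (Fin k → ℤ) → ℝ := fun B =>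
    (∫⁻ ω, (B.sup fun t => spectralField W P' t ω) ∂P').toReal
  have hfin : ∀ B : Finset (Fin k → ℤ),
      ∫⁻ ω, (B.sup fun t => spectralField W P' t ω) ∂P' ≠ ∞ := fun B =>
    ne_top_of_le_ne_top (ENNReal.natCast_ne_top _) (hW.lintegral_sup_spectralField_le B)
  have hcle : ∫⁻ ω, (A.sup fun t => spectralField W P' t ω) ⊓ spectralField W P' 0 ω ∂P' ≤ 1 :=
    (lintegral_mono fun ω => inf_le_right).trans (hW.lintegral_spectralField 0).le
  have hc1 : c ≤ 1 := ENNReal.toReal_mono ENNReal.one_ne_top hcle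
  have hc0 : 0 ≤ c := ENNReal.toReal_nonneg
  have hθ0 : 0 ≤ θ A := ENNReal.toReal_nonneg
  have hθcard : θ A ≤ A.card := by
    simpa using ENNReal.toReal_mono (ENNReal.natCast_ne_top _)
      (hW.lintegral_sup_spectralField_le A)
  -- Integrated form of `max + min = sum` for `max_A Y` and `Y(0)`.
  have hsum : θ (insert 0 A) + c = θ A + 1 := by
    have h : ∫⁻ ω, ((insert 0 A).sup fun t => spectralField W P' t ω) ∂P' +
        ∫⁻ ω, (A.sup fun t => spectralField W P' t ω) ⊓ spectralField W P' 0 ω ∂P' =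
        ∫⁻ ω, (A.sup fun t => spectralField W P' t ω) ∂P' + 1 := by
      rw [← hW.lintegral_spectralField 0, ← lintegral_add_left
        (hW.measurable_sup_spectralField _), ← lintegral_add_left
        (hW.measurable_sup_spectralField _)]
      refine lintegral_congr fun ω => ?_
      rw [Finset.sup_insert, sup_comm]
      exact max_add_min _ _
    have h' := congrArg ENNReal.toReal h
    rwa [ENNReal.toReal_add (hfin _) (ne_top_of_le_ne_top ENNReal.one_ne_top hcle),
      ENNReal.toReal_add (hfin _) ENNReal.one_ne_top, ENNReal.toReal_one] at h'
  have hb : θ (insert 0 A) = θ A + 1 - c := by linarith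
  have hm0 : MeasurableSet {ω | x < ‖X 0 ω‖} := measurableSet_lt measurable_const (hXm 0).norm
  have hmA := measurableSet_lt_fieldMax hXm A hx.le
  have hunion : {ω | x < ‖X 0 ω‖} ∪ {ω | x < fieldMax X A ω} =
      {ω | x < fieldMax X (insert 0 A) ω} := by
    ext ω
    simp [lt_fieldMax_iff hx.le]
  have htail : ∀ B, P.real {ω | x < fieldMax X B ω} = 1 - Real.exp (-(θ B / x)) := by
    rw [hX]
    exact fun B => hin.measureReal_lt_fieldMax hW B hx
  have hinter := measureReal_union_add_inter (μ := P) (s := {ω | x < ‖X 0 ω‖}) hmA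
  rw [hunion, htail, htail, hin.measureReal_lt_norm hW hX 0 hx] at hinter
  have hp : p = ((1 - Real.exp (-(1 / x))) + (1 - Real.exp (-(θ A * (1 / x)))) -
      (1 - Real.exp (-((θ A + 1 - c) * (1 / x))))) / (1 - Real.exp (-(1 / x))) := by
    have : p = (P.real {ω | x < ‖X 0 ω‖})⁻¹ *
        P.real ({ω | x < ‖X 0 ω‖} ∩ {ω | x < fieldMax X A ω}) := by
      simp only [p, cond_apply hm0, ENNReal.toReal_mul, ENNReal.toReal_inv, measureReal_def]
    rw [this, hin.measureReal_lt_norm hW hX 0 hx, ← hb, mul_one_div, mul_one_div,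
      eq_sub_of_add_eq' hinter, inv_mul_eq_div]
  have hy : 0 < 1 / x := by positivity
  rw [hp]
  refine ⟨le_tail_ratio hθ0 hc0 hc1 hy, (tail_ratio_le hθ0 hc0 hc1 hy).trans ?_⟩
  rw [mul_one_div]
  gcongr

/-- The exceedance probabilities tend to 0, while every fixed level is exceeded with positive
probability. -/
lemma tendsto_threshold_atTop (hk : 0 < k) (hW : IsStationaryIncrementGaussianField W P')
    (hin : IsBrownResnickInput W P' Wc U P)
    (hX : X = fun t => brownResnickField U Wc (fun s => variance (W s) P') (gridPoint t))
    {τ : ℝ} {u : (Fin k → ℕ) → ℝ} (hu : IsThresholdArray X P τ u) :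
    Tendsto u atTop atTop := by
  have hp : Tendsto (fun n => P.real {ω | u n < ‖X 0 ω‖}) atTop (𝓝 0) := by
    refine (hu.div_atTop (tendsto_prod_natCast_atTop hk)).congr' ?_
    filter_upwards [(tendsto_prod_natCast_atTop hk).eventually_gt_atTop 0] with n hn
    rw [mul_div_cancel_left₀ _ hn.ne']
  refine tendsto_atTop.2 fun b => ?_
  -- The tail formula needs a positive level.
  have hK : 0 < max b 1 := lt_max_of_lt_right one_pos
  have hpos : 0 < P.real {ω | max b 1 < ‖X 0 ω‖} := by
    rw [hin.measureReal_lt_norm hW hX 0 hK]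
    simp
  filter_upwards [hp.eventually_lt_const hpos] with n hn
  by_contra! hlt
  refine hn.not_ge (measureReal_mono fun ω hω => ?_)
  exact (hlt.trans_le (le_max_left b 1)).trans hω

/-- From `y ≤ e^y (1 - e^{-y})` at `y = 1 / u n`, the quotient is at most `∏ (2 r_l / n_l)` times
`e^{1/u_n}` times `(∏ n_l) P(|X(0)| > u_n)`; these three factors tend to 0, 1 and `τ`. -/
lemma tendsto_card_div_threshold (hk : 0 < k) (hW : IsStationaryIncrementGaussianField W P')
    (hin : IsBrownResnickInput W P' Wc U P)
    (hX : X = fun t => brownResnickField U Wc (fun s => variance (W s) P') (gridPoint t))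
    {τ : ℝ} {u : (Fin k → ℕ) → ℝ} (hu : IsThresholdArray X P τ u)
    {r : (Fin k → ℕ) → (Fin k → ℕ)} (hr : IsBlockArray r) :
    Tendsto (fun n => ((hypercube (r n)).card : ℝ) / u n) atTop (𝓝 0) := by
  have hutop := hin.tendsto_threshold_atTop hk hW hX hu
  have hprod : Tendsto (fun n : Fin k → ℕ => ∏ l, (2 * ((r n l : ℝ) / n l))) atTop (𝓝 0) := by
    have h := tendsto_finsetProd (Finset.univ : Finset (Fin k))
      fun l _ => (hr.negligible l).const_mul 2
    simpa [hk.ne'] using h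
  have hexp : Tendsto (fun n => Real.exp (1 / u n)) atTop (𝓝 1) := by
    have h := (Real.continuous_exp.tendsto _).comp
      ((tendsto_const_nhds (x := (1 : ℝ))).div_atTop hutop)
    simpa [Function.comp_def] using h
  have hlim := hprod.mul (hexp.mul hu)
  rw [zero_mul] at hlim
  refine squeeze_zero' ?_ ?_ hlim
  · filter_upwards [hutop.eventually_gt_atTop 0] with n hn
    positivity
  · filter_upwards [hutop.eventually_gt_atTop 0, eventually_ge_atTop (1 : Fin k → ℕ)] with n hn h1
    have hnl : ∀ l, (n l : ℝ) ≠ 0 := fun l =>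
      Nat.cast_ne_zero.2 (Nat.one_le_iff_ne_zero.1 (h1 l))
    have hcancel : (∏ l, (2 * ((r n l : ℝ) / n l))) * ∏ l, (n l : ℝ) =
        ∏ l, (2 * (r n l : ℝ)) := by
      rw [← Finset.prod_mul_distrib]
      refine Finset.prod_congr rfl fun l _ => ?_
      rw [mul_assoc, div_mul_cancel₀ _ (hnl l)]
    calc ((hypercube (r n)).card : ℝ) / u n = (hypercube (r n)).card * (1 / u n) := by
          rw [mul_one_div]
      _ ≤ (∏ l, (2 * (r n l : ℝ))) *
          (Real.exp (1 / u n) * (1 - Real.exp (-(1 / u n)))) :=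
        mul_le_mul (card_hypercube_le _) (le_exp_mul_one_sub_exp_neg _) (by positivity)
          (by positivity)
      _ = _ := by
        rw [← hcancel, hin.measureReal_lt_norm hW hX 0 hn]
        ring

lemma tendsto_cond_fieldMax (hk : 0 < k) (hW : IsStationaryIncrementGaussianField W P')
    (hin : IsBrownResnickInput W P' Wc U P)
    (hX : X = fun t => brownResnickField U Wc (fun s => variance (W s) P') (gridPoint t))
    {τ : ℝ} {u : (Fin k → ℕ) → ℝ} (hu : IsThresholdArray X P τ u)
    {r : (Fin k → ℕ) → (Fin k → ℕ)} (hr : IsBlockArray r) (M : ℕ) :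
    Tendsto (fun n => cond P {ω | u n < ‖X 0 ω‖}
        {ω | u n < fieldMax X (hypercube (r n) \ hypercube fun _ => M) ω}) atTop
      (𝓝 (clusterLimit W P' M)) := by
  have hutop := hin.tendsto_threshold_atTop hk hW hX hu
  have hL : clusterLimit W P' M ≠ ∞ := ne_top_of_le_ne_top ENNReal.one_ne_top
    ((lintegral_mono fun ω => inf_le_right).trans (hW.lintegral_spectralField 0).le)
  have hc := (ENNReal.tendsto_toReal hL).comp (hW.tendsto_lintegral_sup_inf hr.tendsto_atTop M)
  have hcond : ∀ s t : Set Ω, cond P s t ≠ ∞ := fun s t => by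
    refine ne_top_of_le_ne_top ENNReal.one_ne_top ?_
    rcases eq_or_ne (P s) 0 with h0 | h0
    · simp [cond_eq_zero_of_meas_eq_zero h0]
    · have := cond_isProbabilityMeasure h0
      exact prob_le_one
  rw [← ENNReal.tendsto_toReal_iff (fun n => hcond _ _) hL]
  have hexp : Tendsto (fun n => Real.exp (1 / u n) - 1) atTop (𝓝 0) := by
    have h := ((Real.continuous_exp.tendsto _).comp
      ((tendsto_const_nhds (x := (1 : ℝ))).div_atTop hutop)).sub_const 1
    simpa using h
  have hlow := hc.sub hexp
  have hupp := hc.add (hin.tendsto_card_div_threshold hk hW hX hu hr)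
  rw [sub_zero] at hlow
  rw [add_zero] at hupp
  refine tendsto_of_tendsto_of_tendsto_of_le_of_le' hlow hupp ?_ ?_
  · filter_upwards [hutop.eventually_gt_atTop 0] with n hn
    exact (hin.cond_lt_fieldMax_bounds hW hX _ hn).1
  · filter_upwards [hutop.eventually_gt_atTop 0] with n hn
    refine (hin.cond_lt_fieldMax_bounds hW hX _ hn).2.trans ?_
    simp only [Function.comp_apply]
    gcongr
    exact Finset.sdiff_subset

lemma vanishesAlong_iff (hk : 0 < k) (hW : IsStationaryIncrementGaussianField W P')
    (hin : IsBrownResnickInput W P' Wc U P)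
    (hX : X = fun t => brownResnickField U Wc (fun s => variance (W s) P') (gridPoint t))
    {τ : ℝ} {u : (Fin k → ℕ) → ℝ} (hu : IsThresholdArray X P τ u)
    {r : (Fin k → ℕ) → (Fin k → ℕ)} (hr : IsBlockArray r) :
    VanishesAlong X P u r ↔ ∀ᵐ ω ∂P', Tendsto (fun t : Fin k → ℤ =>
        W (gridPoint t) ω - variance (W (gridPoint t)) P' / 2) cofinite atBot := by
  rw [← hW.tendsto_clusterLimit_zero_iff, VanishesAlong]
  simp_rw [fun M => (hin.tendsto_cond_fieldMax hk hW hX hu hr M).limsup_eq]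

/-- `AntiClustering` quantifies over all threshold arrays, so one must exist for it to carry
information; here `x (1 - e^{-1/x}) → 1` along `x = ∏ n_l`. -/
lemma isThresholdArray_prod (hk : 0 < k) (hW : IsStationaryIncrementGaussianField W P')
    (hin : IsBrownResnickInput W P' Wc U P)
    (hX : X = fun t => brownResnickField U Wc (fun s => variance (W s) P') (gridPoint t)) :
    IsThresholdArray X P 1 fun n => ∏ l, (n l : ℝ) := by
  have hlim : Tendsto (fun x : ℝ => Real.exp (-(1 / x))) atTop (𝓝 1) := by
    have h := (Real.continuous_exp.tendsto _).comp
      ((tendsto_const_nhds (x := (1 : ℝ))).div_atTop (tendsto_id (α := ℝ))).neg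
    simpa [Function.comp_def] using h
  have hmain : Tendsto (fun x : ℝ => x * (1 - Real.exp (-(1 / x)))) atTop (𝓝 1) := by
    refine tendsto_of_tendsto_of_tendsto_of_le_of_le' hlim tendsto_const_nhds ?_ ?_
    · filter_upwards [eventually_gt_atTop 0] with x hx
      have h := mul_le_mul_of_nonneg_left (le_exp_mul_one_sub_exp_neg (1 / x))
        (mul_nonneg hx.le (Real.exp_pos (-(1 / x))).le)
      rw [mul_right_comm, mul_one_div_cancel hx.ne', one_mul] at h
      calc Real.exp (-(1 / x)) ≤ _ := h
        _ = x * (1 - Real.exp (-(1 / x))) * (Real.exp (-(1 / x)) * Real.exp (1 / x)) := by ring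
        _ = _ := by rw [← Real.exp_add, neg_add_cancel, Real.exp_zero, mul_one]
    · filter_upwards [eventually_gt_atTop 0] with x hx
      calc x * (1 - Real.exp (-(1 / x))) ≤ x * (1 / x) :=
            mul_le_mul_of_nonneg_left (by linarith [Real.add_one_le_exp (-(1 / x))]) hx.le
        _ = 1 := mul_one_div_cancel hx.ne'
  refine (hmain.comp (tendsto_prod_natCast_atTop hk)).congr' ?_
  filter_upwards [(tendsto_prod_natCast_atTop hk).eventually_gt_atTop 0] with n hn
  rw [hin.measureReal_lt_norm hW hX 0 hn]
  rfl

end IsBrownResnickInput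

end ConditionalTails

theorem mainTheorem9 {k : ℕ} (hk : 0 < k)
    {Ω Ω' : Type*} [MeasurableSpace Ω] [MeasurableSpace Ω']
    (P : Measure Ω) [IsProbabilityMeasure P] (P' : Measure Ω') [IsProbabilityMeasure P']
    (W : (Fin k → ℝ) → Ω' → ℝ) (hW : IsStationaryIncrementGaussianField W P')
    (Wc : ℕ → (Fin k → ℝ) → Ω → ℝ) (U : ℕ → Ω → ℝ) (hin : IsBrownResnickInput W P' Wc U P)
    (X : (Fin k → ℤ) → Ω → ℝ)
    (hX : X = fun t => brownResnickField U Wc (fun s => variance (W s) P') (gridPoint t)) :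
    (AntiClustering X P ↔
      ∀ᵐ ω ∂P', Tendsto (fun t : Fin k → ℤ =>
        W (gridPoint t) ω - variance (W (gridPoint t)) P' / 2) cofinite atBot) ∧
    -- Moreover, the choice of the arrays in the condition is immaterial.
    (∀ (τ : ℝ) (u : (Fin k → ℕ) → ℝ) (r : (Fin k → ℕ) → (Fin k → ℕ)),
      0 < τ → IsThresholdArray X P τ u → IsBlockArray r →
      (VanishesAlong X P u r ↔
        ∀ᵐ ω ∂P', Tendsto (fun t : Fin k → ℤ =>
          W (gridPoint t) ω - variance (W (gridPoint t)) P' / 2) cofinite atBot)) := by 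
  have hiff : ∀ (τ : ℝ) (u : (Fin k → ℕ) → ℝ) (r : (Fin k → ℕ) → (Fin k → ℕ)),
      0 < τ → IsThresholdArray X P τ u → IsBlockArray r →
      (VanishesAlong X P u r ↔
        ∀ᵐ ω ∂P', Tendsto (fun t : Fin k → ℤ =>
          W (gridPoint t) ω - variance (W (gridPoint t)) P' / 2) cofinite atBot) :=
    fun τ u r _ hu hr => hin.vanishesAlong_iff hk hW hX hu hr
  refine ⟨⟨fun h => ?_, fun h u hu => ?_⟩, hiff⟩
  · have hthreshold := hin.isThresholdArray_prod hk hW hX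
    obtain ⟨r, hr, hvan⟩ := h _ ⟨1, one_pos, hthreshold⟩
    exact (hiff 1 _ r one_pos hthreshold hr).1 hvan
  · obtain ⟨τ, hτ, hu⟩ := hu
    -- Any block array would serve; coordinatewise square roots provide one.
    exact ⟨_, isBlockArray_sqrt, (hiff τ u _ hτ hu isBlockArray_sqrt).2 h⟩
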